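/- Let $d\ge 2$ be a squarefree integer, let $K=\mathbb{Q}(\sqrt d)$ with ring of integers $\mathcal{O}_K$ and norm map $N:K\to\mathbb{Q}$, and let $\omega=\frac{1+\sqrt d}{2}$ if $d\equiv 1\bmod 4$ and $\omega=\sqrt d$ otherwise. Let $\varepsilon>1$ be the fundamental unit of $\mathcal{O}_K$, i.e. $\varepsilon$ is the unit with $\varepsilon>1$ and $\mathcal{O}_K^\times=\{\pm\varepsilon^k:k\in\mathbb{Z}\}$, and write $\varepsilon=x+y\omega$ with nonnegative integers $x,y$. For each integer $f\ge 1$ let $\mathcal{O}_f=\mathbb{Z}+f\mathcal{O}_K$ be the order of conductor $f$ in $K$, let $\mathrm{Pic}(\mathcal{O}_f)$ be its Picard group, and let $h(d)=|\mathrm{Pic}(\mathcal{O}_K)|$. Say that $d$ satisfies (RC) if $$\{f\in\mathbb{Z}_{\ge 1}: h(d)=|\mathrm{Pic}(\mathcal{O}_f)|\}=\{1\}.$$ Then $d$ satisfies (RC) if and only if $N(\varepsilon)=1$, $d\not\equiv 1\bmod 8$, $y$ is even and $d\mid y$. -/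

import Mathlib

open scoped NumberField

/-- The real quadratic number field `K = ℚ(√d)`, as a subfield of `ℝ`. -/
noncomputable abbrev RealQuadField (d : ℕ) : IntermediateField ℚ ℝ :=
  IntermediateField.adjoin ℚ {Real.sqrt d}

/-- The second element `ω` of the integral basis `1, ω` of the ring of integers of `ℚ(√d)`,
as a real number. -/
noncomputable def quadOmega (d : ℕ) : ℝ :=
  if d % 4 = 1 then (1 + Real.sqrt d) / 2 else Real.sqrt d

/-- The subring `ℤ + f R` of a commutative ring `R`. For `R = 𝓞 K` and `f ≥ 1` it is the order
`𝒪_f` of conductor `f` in `K`. -/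
def orderOfConductor (R : Type*) [CommRing R] (f : ℕ) : Subring R where
  carrier := {z | ∃ (a : ℤ) (w : R), z = a + f * w}
  mul_mem' := by
    rintro _ _ ⟨a, v, rfl⟩ ⟨b, w, rfl⟩
    exact ⟨a * b, a * w + b * v + f * v * w, by push_cast; ring⟩
  one_mem' := ⟨1, 0, by simp⟩
  add_mem' := by
    rintro _ _ ⟨a, v, rfl⟩ ⟨b, w, rfl⟩
    exact ⟨a + b, v + w, by push_cast; ring⟩
  zero_mem' := ⟨0, 0, by simp⟩
  neg_mem' := by
    rintro _ ⟨a, v, rfl⟩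
    exact ⟨-a, -v, by push_cast; ring⟩

/-- The class number `h(d) = |Pic(𝓞 K)|` of `K = ℚ(√d)`. -/
noncomputable def quadClassNumber (d : ℕ) : ℕ :=
  Nat.card (CommRing.Pic (𝓞 (RealQuadField d)))

/-- Condition (RC): `d` has no nontrivial conductors of relative class number one, that is,
`{f ∈ ℕ : h(d) = |Pic(𝒪_f)|} = {1}`, where `f` runs over the positive integers. -/
def SatisfiesRC (d : ℕ) : Prop :=
  {f : ℕ | 0 < f ∧
    quadClassNumber d = Nat.card (CommRing.Pic (orderOfConductor (𝓞 (RealQuadField d)) f))} = {1}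

/-- `ε` is the fundamental unit `> 1` of the ring of integers of `K = ℚ(√d)`: `ε > 1` as a real
number and every unit is of the form `± ε ^ k` with `k ∈ ℤ`. -/
def IsFundamentalUnit (d : ℕ) (ε : (𝓞 (RealQuadField d))ˣ) : Prop :=
  1 < (((ε : 𝓞 (RealQuadField d)) : RealQuadField d) : ℝ) ∧
    ∀ u : (𝓞 (RealQuadField d))ˣ, ∃ k : ℤ, u = ε ^ k ∨ u = -ε ^ k

/-! Extension of scalars Pic(O_f) → Pic(O_K) is surjective, because every ideal class of O_K
contains an integral ideal prime to f. So h(d) = |Pic(O_f)| means that its kernel is trivial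
(`card_pic_orderOfConductor_eq_iff`). The kernel is (O_K/f)ˣ/(ℤ/f)ˣ modulo the image of the units,
so triviality says that each b prime to f is moved into O_f by a unit. This passes from f to every
prime p ∣ f; hence (RC) says that for no prime p do the powers of ε fill G_p = (O_K/p)ˣ/(ℤ/p)ˣ
(`satisfiesRC_iff`).

The class of ε in G_p is trivial exactly when p ∣ y. The group G_2 has order 1, 2 or 3 as 2 splits,
ramifies or is inert, so ε fills it iff d ≡ 1 mod 8 or y is odd. For odd p ∣ d, G_p has order p and
ε fills it iff p ∤ y. For the other odd p, the norm modulo squares is a nontrivial character of G_p;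
if N(ε) = 1 it kills ε, which then cannot fill G_p. If N(ε) = -1, then 3 is unramified and ε fills
G_3. -/

/-! ### Picard groups and extension of scalars -/

namespace Submodule

/-- Extension of scalars `I ↦ B I` for submodules of an algebra over a tower `A → B → K`. -/
noncomputable def extendScalarsHom (A B K : Type*) [CommRing A] [CommRing B] [CommRing K]
    [Algebra A B] [Algebra A K] [Algebra B K] [IsScalarTower A B K] :
    Submodule A K →* Submodule B K where
  toFun I := span B (I : Set K)
  map_one' := by
    refine le_antisymm (span_le.2 ?_) (one_le.2 (subset_span (one_le.1 le_rfl)))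
    rintro _ hx
    obtain ⟨a, rfl⟩ := mem_one.1 hx
    exact mem_one.2 ⟨algebraMap A B a, (IsScalarTower.algebraMap_apply A B K a).symm⟩
  map_mul' I J := by
    rw [span_mul_span]
    refine le_antisymm (span_le.2 fun x hx => ?_) (span_mono ?_)
    · induction hx using Submodule.mul_induction_on' with
      | mem_mul_mem m hm n hn => exact subset_span (Set.mul_mem_mul hm hn)
      | add x _ y _ hx hy => exact add_mem hx hy
    · rintro _ ⟨x, hx, y, hy, rfl⟩
      exact mul_mem_mul hx hy

section

variable (A B K : Type*) [CommRing A] [CommRing B] [CommRing K]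
    [Algebra A B] [Algebra A K] [Algebra B K] [IsScalarTower A B K]

theorem extendScalarsHom_apply (I : Submodule A K) :
    extendScalarsHom A B K I = span B (I : Set K) := rfl

theorem extendScalarsHom_span_singleton (x : K) :
    extendScalarsHom A B K (span A {x}) = span B {x} := by
  refine le_antisymm (span_le.2 fun y hy => ?_) (span_mono subset_span)
  obtain ⟨a, rfl⟩ := mem_span_singleton.1 hy
  rw [SetLike.mem_coe, ← IsScalarTower.algebraMap_smul B a x]
  exact smul_mem _ _ (mem_span_singleton_self x)

end

variable {A B K : Type*} [CommRing A] [CommRing B] [Field K] [Algebra A B] [Algebra A K]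
  [Algebra B K] [IsScalarTower A B K] [FaithfulSMul A K] [FaithfulSMul B K]

theorem unitsToPic_surjective : Function.Surjective (unitsToPic A K) := by
  rw [← MonoidHom.range_eq_top, range_unitsToPic, CommRing.relPic_eq_top]

theorem unitsToPic_eq_one_iff (I : (Submodule A K)ˣ) :
    unitsToPic A K I = 1 ↔ ∃ x : Kˣ, (I : Submodule A K) = span A {(x : K)} := by
  rw [← MonoidHom.mem_ker, ker_unitsToPic]
  constructor
  · rintro ⟨x, rfl⟩
    exact ⟨x, rfl⟩
  · rintro ⟨x, hx⟩
    exact ⟨x, Units.ext hx.symm⟩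

-- Picard classes are invertible submodules of `K` modulo principal ones, and principal submodules
-- stay principal over `B`, so extension of scalars descends to classes.
variable (A B K) in
theorem exists_pic_hom : ∃ φ : CommRing.Pic A →* CommRing.Pic B, ∀ I : (Submodule A K)ˣ,
    φ (unitsToPic A K I) = unitsToPic B K (Units.map (extendScalarsHom A B K) I) := by
  have h : (unitsToPic A K).ker ≤
      ((unitsToPic B K).comp (Units.map (extendScalarsHom A B K))).ker := by
    intro I hI
    obtain ⟨x, hx⟩ := (unitsToPic_eq_one_iff I).1 hI
    refine (unitsToPic_eq_one_iff _).2 ⟨x, ?_⟩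
    rw [Units.coe_map, hx]
    exact extendScalarsHom_span_singleton A B K x
  exact ⟨(unitsToPic A K).liftOfSurjective unitsToPic_surjective ⟨_, h⟩, fun I =>
    MonoidHom.liftOfRightInverse_comp_apply _ _ _ ⟨_, h⟩ I⟩

/-- If `Pic A → Pic B` is surjective and `Pic B` is finite, then the two groups have the same
cardinality exactly when an invertible submodule that becomes principal over `B` is principal. -/
theorem card_pic_eq_iff [Finite (CommRing.Pic B)]
    (hs : ∀ J : (Submodule B K)ˣ, ∃ I : (Submodule A K)ˣ, ∃ x : Kˣ,
      extendScalarsHom A B K I = span B {(x : K)} * J) :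
    Nat.card (CommRing.Pic B) = Nat.card (CommRing.Pic A) ↔
      ∀ I : (Submodule A K)ˣ, (∃ x : Kˣ, extendScalarsHom A B K I = span B {(x : K)}) →
        ∃ x : Kˣ, (I : Submodule A K) = span A {(x : K)} := by
  obtain ⟨φ, hφ⟩ := exists_pic_hom A B K
  have hsurj : Function.Surjective φ := by
    intro c
    obtain ⟨J, rfl⟩ := unitsToPic_surjective (K := K) c
    obtain ⟨I, x, hx⟩ := hs J
    refine ⟨unitsToPic A K I, ?_⟩
    rw [hφ, ← mul_inv_eq_one, ← map_inv, ← map_mul, unitsToPic_eq_one_iff]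
    refine ⟨x, ?_⟩
    rw [Units.val_mul, Units.coe_map]
    change extendScalarsHom A B K I * _ = _
    rw [hx, mul_assoc, Units.mul_inv, mul_one]
  have hinj : Function.Injective φ ↔ ∀ I : (Submodule A K)ˣ,
      (∃ x : Kˣ, extendScalarsHom A B K I = span B {(x : K)}) →
        ∃ x : Kˣ, (I : Submodule A K) = span A {(x : K)} := by
    rw [injective_iff_map_eq_one, unitsToPic_surjective (K := K) |>.forall]
    refine forall_congr' fun I => ?_
    rw [hφ, unitsToPic_eq_one_iff, unitsToPic_eq_one_iff]
    rfl
  rw [← hinj]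
  constructor
  · intro h
    -- An infinite `Pic A` would have `Nat.card` equal to 0, whereas that of `Pic B` is positive.
    have : Finite (CommRing.Pic A) := Nat.finite_of_card_ne_zero (h ▸ Nat.card_pos.ne')
    exact (hsurj.bijective_of_nat_card_le h.ge).1
  · intro h
    exact (Nat.card_congr (Equiv.ofBijective φ ⟨h, hsurj⟩)).symm

end Submodule

/-! ### Orders of conductor f: surjectivity on Picard groups and the kernel -/

section Conductor

open Submodule

variable {B K : Type*} [CommRing B] [Field K] [Algebra B K]

/-- Clear denominators to get an ideal I = cJ⁻¹ and choose a ∈ I with I = nI + (a). Then x = a/c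
lies in J⁻¹, and xJ = aI⁻¹ is integral and prime to n. -/
theorem exists_unit_smul_coprime [IsDedekindDomain B] [IsFractionRing B K] {n : B} (hn : n ≠ 0)
    (J : (Submodule B K)ˣ) : ∃ x : Kˣ, span B {(x : K)} * (J : Submodule B K) ≤ 1 ∧
      ∃ b : B, 1 - algebraMap B K (n * b) ∈ span B {(x : K)} * (J : Submodule B K) := by
  set J' : Submodule B K := ((J⁻¹ : (Submodule B K)ˣ) : Submodule B K) with hJ'
  have hJJ : J' * (J : Submodule B K) = 1 := J.inv_mul
  have hfg : J'.FG := Submodule.fg_of_isUnit (J⁻¹).isUnit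
  obtain ⟨c, hc, hcJ⟩ := FractionalIdeal.isFractional_of_fg (S := nonZeroDivisors B) hfg
  have hc0 : algebraMap B K c ≠ 0 :=
    (map_ne_zero_iff _ (IsFractionRing.injective B K)).2 (nonZeroDivisors.ne_zero hc)
  set I : Ideal B := (span B {algebraMap B K c} * J').comap (Algebra.linearMap B K) with hI
  have memI : ∀ b : B, b ∈ I ↔ ∃ y ∈ J', algebraMap B K c * y = algebraMap B K b := by
    intro b
    rw [hI, mem_comap, mem_span_singleton_mul]
    rfl
  have hJ0 : J' ≠ ⊥ := by
    intro h
    rw [h, bot_mul] at hJJ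
    have := one_le.1 (le_of_eq hJJ.symm)
    rw [mem_bot] at this
    exact one_ne_zero this
  have hI0 : ∃ a ∈ I, a ≠ 0 := by
    obtain ⟨y, hy, hy0⟩ := exists_mem_ne_zero_of_ne_bot hJ0
    obtain ⟨a, ha⟩ := hcJ y hy
    rw [Algebra.smul_def] at ha
    refine ⟨a, (memI a).2 ⟨y, hy, ha.symm⟩, fun h => ?_⟩
    rw [h, map_zero] at ha
    exact mul_ne_zero hc0 hy0 ha.symm
  have hle : Ideal.span {n} * I ≤ I := Ideal.mul_le_right
  have hne : Ideal.span {n} * I ≠ 0 := by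
    obtain ⟨a, ha, ha0⟩ := hI0
    refine mul_ne_zero (by simpa using hn) fun h => ha0 ?_
    rw [h] at ha
    simpa using ha
  obtain ⟨a, haI, ha0, ha⟩ : ∃ a ∈ I, a ≠ 0 ∧ ∀ z ∈ I, ∃ i ∈ I, ∃ b, z = n * i + b * a := by
    obtain ⟨a, ha⟩ := IsDedekindDomain.exists_sup_span_eq hle hne
    have key : ∀ z ∈ I, ∃ i ∈ I, ∃ b, z = n * i + b * a := by
      intro z hz
      rw [← ha] at hz
      obtain ⟨u, hu, v, hv, rfl⟩ := mem_sup.1 hz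
      obtain ⟨i, hi, rfl⟩ := Ideal.mem_span_singleton_mul.1 hu
      obtain ⟨b, rfl⟩ := Ideal.mem_span_singleton'.1 hv
      exact ⟨i, hi, b, rfl⟩
    -- If a = 0 then I = nI already, and any nonzero element of I can replace a.
    by_cases h0 : a = 0
    · obtain ⟨a', ha', ha0'⟩ := hI0
      refine ⟨a', ha', ha0', fun z hz => ?_⟩
      obtain ⟨i, hi, b, rfl⟩ := key z hz
      exact ⟨i, hi, 0, by simp [h0]⟩
    · exact ⟨a, ha ▸ mem_sup_right (Ideal.mem_span_singleton_self a), h0, key⟩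
  obtain ⟨x, hxJ, hx⟩ := (memI a).1 haI
  have hx0 : x ≠ 0 := by
    rintro rfl
    rw [mul_zero] at hx
    exact (map_ne_zero_iff _ (IsFractionRing.injective B K)).2 ha0 hx.symm
  refine ⟨Units.mk0 x hx0, ?_, ?_⟩
  · rw [← hJJ]
    exact mul_le_mul_left ((span_singleton_le_iff_mem _ _).2 hxJ) _
  · have hall : ∀ z ∈ J' * (J : Submodule B K),
        ∃ b : B, z - algebraMap B K (n * b) ∈ span B {x} * (J : Submodule B K) := by
      intro z hz
      induction hz using Submodule.mul_induction_on' with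
      | mem_mul_mem m hm k hk =>
        obtain ⟨a₀, ha₀⟩ := hcJ m hm
        rw [Algebra.smul_def] at ha₀
        obtain ⟨i, hi, b, hib⟩ := ha a₀ ((memI _).2 ⟨m, hm, ha₀.symm⟩)
        obtain ⟨j, hj, hij⟩ := (memI i).1 hi
        obtain ⟨w, hw⟩ := mem_one.1 (hJJ ▸ mul_mem_mul hj hk)
        refine ⟨w, mem_span_singleton_mul.2 ⟨b • k, smul_mem _ _ hk, ?_⟩⟩
        have hm' : m = algebraMap B K n * j + algebraMap B K b * x := by
          apply mul_left_cancel₀ hc0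
          rw [← ha₀, hib, map_add, map_mul, map_mul, ← hij, ← hx]
          ring
        rw [map_mul, hw, Algebra.smul_def, hm']
        ring
      | add y _ z _ hy hz =>
        obtain ⟨b, hb⟩ := hy
        obtain ⟨b', hb'⟩ := hz
        refine ⟨b + b', ?_⟩
        have := add_mem hb hb'
        rw [mul_add, map_add]
        convert this using 1
        ring
    exact hall 1 (hJJ ▸ one_le.1 le_rfl)

variable {f : ℕ}

theorem natCast_mul_mem_orderOfConductor (b : B) : (f : B) * b ∈ orderOfConductor B f :=
  ⟨0, b, by simp⟩

theorem algebraMap_mem_one_iff [FaithfulSMul B K] {b : B} :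
    algebraMap B K b ∈ (1 : Submodule (orderOfConductor B f) K) ↔ b ∈ orderOfConductor B f := by
  rw [mem_one]
  constructor
  · rintro ⟨y, hy⟩
    have : (y : B) = b := FaithfulSMul.algebraMap_injective B K hy
    exact this ▸ y.2
  · intro h
    exact ⟨⟨b, h⟩, rfl⟩

theorem algebraMap_mul_mem {M : Submodule (orderOfConductor B f) K} {a : B} {x : K}
    (ha : a ∈ orderOfConductor B f) (hx : x ∈ M) : algebraMap B K a * x ∈ M :=
  (Algebra.smul_def a x) ▸ M.smul_mem ⟨a, ha⟩ hx

/-- An integral J prime to f is extended from its contraction J ∩ O_f, whose inverse is O_f + fJ⁻¹.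
-/
theorem exists_extendScalarsHom_eq [FaithfulSMul B K] (J : (Submodule B K)ˣ)
    (hJ : (J : Submodule B K) ≤ 1)
    (b : B) (hb : 1 - algebraMap B K (f * b) ∈ (J : Submodule B K)) :
    ∃ I : (Submodule (orderOfConductor B f) K)ˣ,
      extendScalarsHom (orderOfConductor B f) B K I = J := by
  set J' : Submodule B K := ((J⁻¹ : (Submodule B K)ˣ) : Submodule B K) with hJ'
  have hJJ : (J : Submodule B K) * J' = 1 := J.mul_inv
  let I : Submodule (orderOfConductor B f) K := (J : Submodule B K).restrictScalars _ ⊓ 1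
  let I' : Submodule (orderOfConductor B f) K :=
    1 ⊔ span (orderOfConductor B f) {algebraMap B K f} * J'.restrictScalars _
  have hbA : (1 - f * b : B) ∈ orderOfConductor B f :=
    sub_mem (one_mem _) (natCast_mul_mem_orderOfConductor b)
  have hbI : 1 - algebraMap B K (f * b) ∈ I := by
    refine mem_inf.2 ⟨hb, ?_⟩
    have := (algebraMap_mem_one_iff (K := K)).2 hbA
    rwa [map_sub, map_one] at this
  have hfI : ∀ x ∈ (J : Submodule B K), algebraMap B K f * x ∈ I := by
    intro x hx
    refine mem_inf.2 ⟨?_, ?_⟩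
    · exact (Algebra.smul_def (f : B) x) ▸ (J : Submodule B K).smul_mem _ hx
    · obtain ⟨w, rfl⟩ := mem_one.1 (hJ hx)
      rw [← map_mul, algebraMap_mem_one_iff]
      exact natCast_mul_mem_orderOfConductor w
  have hII : I * I' = 1 := by
    refine le_antisymm (mul_le.2 fun m hm n hn => ?_) (one_le.2 ?_)
    · obtain ⟨u, hu, v, hv, rfl⟩ := mem_sup.1 hn
      rw [mul_add]
      refine add_mem ?_ ?_
      · have := mul_mem_mul (mem_inf.1 hm).2 hu
        rwa [mul_one] at this
      · obtain ⟨j, hj, rfl⟩ := mem_span_singleton_mul.1 hv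
        have h1 : m * j ∈ (1 : Submodule B K) := hJJ ▸ mul_mem_mul (mem_inf.1 hm).1 hj
        obtain ⟨w, hw⟩ := mem_one.1 h1
        rw [mul_left_comm, ← hw, ← map_mul, algebraMap_mem_one_iff]
        exact natCast_mul_mem_orderOfConductor w
    · have hf2 : ∀ z ∈ (J : Submodule B K) * J',
          algebraMap B K f * algebraMap B K f * z ∈ I * I' := by
        intro z hz
        induction hz using Submodule.mul_induction_on' with
        | mem_mul_mem m hm n hn =>
          rw [mul_mul_mul_comm]
          exact mul_mem_mul (hfI m hm)
            (mem_sup_right (mul_mem_mul (mem_span_singleton_self _) hn))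
        | add x _ y _ hx hy =>
          rw [mul_add]
          exact add_mem hx hy
      -- The decomposition is 1 = f²b² + (1 - fb)(1 + fb).
      have h1 := hf2 (algebraMap B K (b * b)) (hJJ ▸ mem_one.2 ⟨_, rfl⟩)
      have h2 : (1 - algebraMap B K (f * b)) * (algebraMap B K (1 + f * b)) ∈ I * I' :=
        mul_mem_mul hbI (mem_sup_left (algebraMap_mem_one_iff.2
          (add_mem (one_mem _) (natCast_mul_mem_orderOfConductor b))))
      have h3 := add_mem h1 h2
      convert h3 using 1
      simp only [map_mul, map_add, map_one]
      ring
  refine ⟨⟨I, I', hII, mul_comm I I' ▸ hII⟩, le_antisymm (span_le.2 fun x hx => ?_) ?_⟩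
  · exact (mem_inf.1 hx).1
  · intro z hz
    obtain ⟨w, rfl⟩ := mem_one.1 (hJ hz)
    change algebraMap B K w ∈ span B (I : Set K)
    -- Here w = w(1 - fb) + b(fw), with 1 - fb and fw both in I.
    have h1 := smul_mem (span B (I : Set K)) w (subset_span hbI)
    have h2 := smul_mem (span B (I : Set K)) b (subset_span (hfI _ hz))
    have h3 := add_mem h1 h2
    convert h3 using 1
    rw [Algebra.smul_def, Algebra.smul_def, map_mul]
    ring

/-- Every element of `B` prime to `f` is, up to a unit of `B`, in the order `ℤ + f B`. -/
def UnitsGenerateModulo (B : Type*) [CommRing B] (f : ℕ) : Prop :=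
  ∀ b : B, IsCoprime b (f : B) → ∃ u : Bˣ, (u : B) * b ∈ orderOfConductor B f

theorem orderOfConductor_le_of_dvd {f g : ℕ} (h : g ∣ f) :
    orderOfConductor B f ≤ orderOfConductor B g := by
  rintro _ ⟨a, w, rfl⟩
  obtain ⟨k, rfl⟩ := h
  exact ⟨a, k * w, by push_cast; ring⟩

theorem mem_orderOfConductor_add_mul_iff {b w : B} :
    b + f * w ∈ orderOfConductor B f ↔ b ∈ orderOfConductor B f :=
  ⟨fun h => by simpa using sub_mem h (natCast_mul_mem_orderOfConductor w),
    fun h => add_mem h (natCast_mul_mem_orderOfConductor w)⟩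

/-- Write f = pᵏ⁺¹g with p ∤ g. By the Chinese remainder theorem, b is congruent mod p to some c
that is 1 mod g and hence prime to f. A unit moving c into O_f ⊆ O_p also moves b into O_p. -/
theorem UnitsGenerateModulo.of_prime_dvd {f p : ℕ} (h : UnitsGenerateModulo B f) (hf : f ≠ 0)
    (hp : p.Prime) (hpf : p ∣ f) : UnitsGenerateModulo B p := by
  obtain ⟨k, g, hg, rfl⟩ := Nat.exists_eq_pow_mul_and_not_dvd hf p hp.ne_one
  have hk : k ≠ 0 := by
    rintro rfl
    exact hg (by simpa using hpf)
  obtain ⟨k, rfl⟩ := Nat.exists_eq_succ_of_ne_zero hk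
  have hcop : IsCoprime ((p : ℤ) ^ (k + 1)) (g : ℤ) :=
    (Nat.isCoprime_iff_coprime.2 ((hp.coprime_iff_not_dvd).2 hg)).pow_left
  obtain ⟨r, s, hrs⟩ := hcop
  have hrs' : (r : B) * p ^ (k + 1) + s * g = 1 := by exact_mod_cast congrArg (Int.cast : ℤ → B) hrs
  intro b hb
  have hc : b * (s * g) + r * p ^ (k + 1) = b + p * (r * p ^ k * (1 - b)) := by
    linear_combination b * hrs'
  have hcp : IsCoprime (b * (s * g) + r * p ^ (k + 1)) (p : B) := by
    rw [hc]
    exact hb.add_mul_left_left _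
  have hcg : IsCoprime (b * (s * g) + r * p ^ (k + 1)) (g : B) :=
    ⟨1, s - b * s, by linear_combination hrs'⟩
  obtain ⟨u, hu⟩ := h (b * (s * g) + r * p ^ (k + 1)) (by
    push_cast
    exact hcp.pow_right.mul_right hcg)
  refine ⟨u, ?_⟩
  have := orderOfConductor_le_of_dvd hpf hu
  rwa [hc, mul_add, mul_left_comm, mem_orderOfConductor_add_mul_iff] at this

/-- For bb' ≡ 1 mod f, the module O_f b + fB is invertible with inverse O_f b' + fB, and it
generates B over B. A generator over O_f is therefore a unit of B, and dividing b by it lands in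
O_f. -/
theorem unitsGenerateModulo_of_principal [FaithfulSMul B K]
    (h : ∀ I : (Submodule (orderOfConductor B f) K)ˣ,
      (∃ x : Kˣ, extendScalarsHom (orderOfConductor B f) B K I = span B {(x : K)}) →
        ∃ x : Kˣ, (I : Submodule (orderOfConductor B f) K) = span _ {(x : K)}) :
    UnitsGenerateModulo B f := by
  rintro b ⟨b', w', hw'⟩
  obtain ⟨w, rfl⟩ : ∃ w, w' = -w := ⟨-w', by simp⟩
  have hw : b * b' = 1 + f * w := by linear_combination hw'
  let F : Submodule (orderOfConductor B f) K :=
    ((1 : Submodule B K).restrictScalars _).map (LinearMap.mulLeft _ (algebraMap B K f))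
  have memF : ∀ c : B, algebraMap B K (f * c) ∈ F := fun c =>
    ⟨algebraMap B K c, mem_one.2 ⟨c, rfl⟩, by simp⟩
  have ofF : ∀ z ∈ F, ∃ c : B, z = algebraMap B K (f * c) := by
    rintro _ ⟨_, hx, rfl⟩
    obtain ⟨c, rfl⟩ := mem_one.1 hx
    exact ⟨c, by simp⟩
  let L : B → Submodule (orderOfConductor B f) K := fun c => span _ {algebraMap B K c} ⊔ F
  have memL : ∀ c, algebraMap B K c ∈ L c := fun c => mem_sup_left (mem_span_singleton_self _)
  have ofL : ∀ c, ∀ z ∈ L c, ∃ a ∈ orderOfConductor B f, ∃ v, z = algebraMap B K (a * c + f * v) := by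
    intro c z hz
    obtain ⟨y, hy, z, hzF, rfl⟩ := mem_sup.1 hz
    obtain ⟨a, rfl⟩ := mem_span_singleton.1 hy
    obtain ⟨v, rfl⟩ := ofF z hzF
    refine ⟨a, a.2, v, ?_⟩
    rw [map_add, map_mul (algebraMap B K) (a : B), ← Algebra.smul_def]
    rfl
  have hLL : L b * L b' = 1 := by
    refine le_antisymm (mul_le.2 fun m hm n hn => ?_) (one_le.2 ?_)
    · obtain ⟨a, ha, v, rfl⟩ := ofL _ _ hm
      obtain ⟨a', ha', v', rfl⟩ := ofL _ _ hn
      rw [← map_mul, algebraMap_mem_one_iff]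
      have : (a * b + f * v) * (a' * b' + f * v') =
          a * a' + f * (a * a' * w + a * b * v' + v * (a' * b') + f * v * v') := by
        linear_combination a * a' * hw
      rw [this]
      exact add_mem (mul_mem ha ha') (natCast_mul_mem_orderOfConductor _)
    -- With bb' = 1 + fw, the identity is 1 = bb' - bb'fw + (fw)².
    · have h1 := mul_mem_mul (memL b) (memL b')
      have h2 : algebraMap B K b * algebraMap B K (f * (b' * -w)) ∈ L b * L b' :=
        mul_mem_mul (memL b) (mem_sup_right (memF _))
      have h3 : algebraMap B K (f * w) * algebraMap B K (f * w) ∈ L b * L b' :=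
        mul_mem_mul (mem_sup_right (memF _)) (mem_sup_right (memF _))
      have h4 := add_mem (add_mem h1 h2) h3
      convert h4 using 1
      rw [← map_mul, ← map_mul, ← map_mul, ← map_add, ← map_add, ← map_one (algebraMap B K)]
      congr 1
      linear_combination (f * w - 1) * hw
  have hext : extendScalarsHom (orderOfConductor B f) B K (L b) = 1 := by
    rw [extendScalarsHom_apply]
    refine le_antisymm (span_le.2 fun z hz => ?_) (one_le.2 ?_)
    · obtain ⟨a, -, v, rfl⟩ := ofL _ _ hz
      exact mem_one.2 ⟨_, rfl⟩
    · have h1 := smul_mem (span B (L b : Set K)) b' (subset_span (memL b))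
      have h2 : algebraMap B K (f * -w) ∈ span B (L b : Set K) :=
        subset_span (mem_sup_right (memF _))
      have h3 := add_mem h1 h2
      convert h3 using 1
      rw [Algebra.smul_def, ← map_mul, ← map_add, ← map_one (algebraMap B K)]
      congr 1
      linear_combination -hw
  obtain ⟨x, hx⟩ := h ⟨L b, L b', hLL, mul_comm (L b) (L b') ▸ hLL⟩
    ⟨1, by rw [Units.val_one, ← one_eq_span, hext]⟩
  change L b = span _ {(x : K)} at hx
  have hxB : span B {(x : K)} = 1 := by
    rw [← extendScalarsHom_span_singleton (orderOfConductor B f), ← hx, hext]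
  obtain ⟨u, hu⟩ := span_singleton_eq_one_iff.1 hxB
  have hb := memL b
  rw [hx] at hb
  obtain ⟨a, ha⟩ := mem_span_singleton.1 hb
  refine ⟨u⁻¹, ?_⟩
  have : (u⁻¹ : Bˣ) * b = (a : B) := by
    rw [Units.inv_mul_eq_iff_eq_mul]
    apply FaithfulSMul.algebraMap_injective B K
    rw [map_mul, ← hu, ← ha, mul_comm, ← Algebra.smul_def]
    rfl
  rw [this]
  exact a.2

/-- After scaling, BM = B and fB ⊆ M ⊆ B. As O_f/fB is a field for f prime, some b ∈ M and b' ∈ M⁻¹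
have product a unit mod fB. So b is prime to f, and a unit u with ub ∈ O_f yields M = O_f u⁻¹. -/
theorem principal_of_unitsGenerateModulo [FaithfulSMul B K] (hf : f = 1 ∨ f.Prime)
    (hf1 : f ≠ 1 → ∀ w : B, f * w ≠ 1) (h : UnitsGenerateModulo B f)
    (I : (Submodule (orderOfConductor B f) K)ˣ)
    (hI : ∃ x : Kˣ, extendScalarsHom (orderOfConductor B f) B K I = span B {(x : K)}) :
    ∃ x : Kˣ, (I : Submodule (orderOfConductor B f) K) = span _ {(x : K)} := by
  obtain ⟨x, hx⟩ := hI
  let A := orderOfConductor B f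
  let X : (Submodule A K)ˣ := Units.map (spanSingleton A).toMonoidHom x
  obtain ⟨I₁, rfl⟩ : ∃ I₁, I = X * I₁ := ⟨X⁻¹ * I, by simp⟩
  have hX : Units.map (extendScalarsHom A B K) X = Units.map (spanSingleton B).toMonoidHom x :=
    Units.ext (extendScalarsHom_span_singleton A B K x)
  have hI₁ : Units.map (extendScalarsHom A B K) I₁ = 1 := by
    have : Units.map (extendScalarsHom A B K) (X * I₁) =
      Units.map (spanSingleton B).toMonoidHom x := Units.ext hx
    rwa [map_mul, hX, mul_eq_left] at this
  have hI₁' : Units.map (extendScalarsHom A B K) I₁⁻¹ = 1 := by rw [map_inv, hI₁, inv_one]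
  have hM : span B ((I₁ : Submodule A K) : Set K) = 1 := congrArg Units.val hI₁
  have hM' : span B (((I₁⁻¹ : (Submodule A K)ˣ) : Submodule A K) : Set K) = 1 :=
    congrArg Units.val hI₁'
  set M : Submodule A K := (I₁ : Submodule A K) with hMdef
  set M' : Submodule A K := ((I₁⁻¹ : (Submodule A K)ˣ) : Submodule A K)
  have hMM : M * M' = 1 := I₁.mul_inv
  have inj := FaithfulSMul.algebraMap_injective B K
  have toB : ∀ z ∈ M, ∃ b, algebraMap B K b = z := fun z hz =>
    mem_one.1 (hM ▸ subset_span hz)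
  have toB' : ∀ z ∈ M', ∃ b, algebraMap B K b = z := fun z hz =>
    mem_one.1 (hM' ▸ subset_span hz)
  have mulO : ∀ b b', algebraMap B K b ∈ M → algebraMap B K b' ∈ M' → b * b' ∈ A := by
    intro b b' hb hb'
    rw [← algebraMap_mem_one_iff (K := K), map_mul]
    exact hMM ▸ mul_mem_mul hb hb'
  have hfM : ∀ c, algebraMap B K (f * c) ∈ M := by
    have key : ∀ z ∈ span B (M : Set K), ∀ c, algebraMap B K (f * c) * z ∈ M := by
      intro z hz
      induction hz using span_induction with
      | mem z hz => exact fun c => algebraMap_mul_mem (natCast_mul_mem_orderOfConductor c) hz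
      | zero => simp
      | add y z _ _ hy hz => exact fun c => mul_add _ y z ▸ add_mem (hy c) (hz c)
      | smul a z _ hz =>
        intro c
        have := hz (c * a)
        rwa [← mul_assoc, map_mul, mul_assoc, ← Algebra.smul_def a z] at this
    exact fun c => by simpa using key 1 (hM ▸ one_le.1 le_rfl) c
  obtain ⟨b, b', a, w, hb, hb', hbb, hcop⟩ : ∃ b b' : B, ∃ a : ℤ, ∃ w : B,
      algebraMap B K b ∈ M ∧ algebraMap B K b' ∈ M' ∧ b * b' = a + f * w ∧
        IsCoprime a (f : ℤ) := by
    rcases eq_or_ne f 1 with h1 | h1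
    -- For f = 1 coprimality is void, so zeros suffice.
    · exact ⟨0, 0, 0, 0, by simp, by simp, by simp, by rw [h1]; exact isCoprime_one_right⟩
    · have hp := hf.resolve_left h1
      -- Otherwise MM⁻¹ ⊆ fB, which does not contain 1.
      by_contra! hno
      have key : ∀ z ∈ M * M', ∃ c, z = algebraMap B K (f * c) := by
        intro z hz
        induction hz using Submodule.mul_induction_on' with
        | mem_mul_mem m hm n hn =>
          obtain ⟨b, rfl⟩ := toB m hm
          obtain ⟨b', rfl⟩ := toB' n hn
          obtain ⟨a, w, haw⟩ := mulO b b' hm hn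
          have hd : (f : ℤ) ∣ a := by
            by_contra hd
            exact hno b b' a w hm hn haw
              (((Nat.prime_iff_prime_int.1 hp).coprime_iff_not_dvd.2 hd).symm)
          obtain ⟨c, rfl⟩ := hd
          refine ⟨c + w, ?_⟩
          rw [← map_mul, haw]
          push_cast
          ring
        | add y _ z _ hy hz =>
          obtain ⟨c, rfl⟩ := hy
          obtain ⟨c', rfl⟩ := hz
          exact ⟨c + c', by rw [← map_add, mul_add]⟩
      obtain ⟨c, hc⟩ := key 1 (hMM ▸ one_le.1 le_rfl)
      exact hf1 h1 c (inj (by rw [← hc, map_one]))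
  obtain ⟨r, s, hrs⟩ := hcop
  have hrs' : (r : B) * a + s * f = 1 := by exact_mod_cast congrArg (Int.cast : ℤ → B) hrs
  obtain ⟨u, n, v, hu⟩ := h b ⟨r * b', s - r * w, by linear_combination r * hbb + hrs'⟩
  have hnb : (n : B) * (u⁻¹ : Bˣ) * b' = a + f * (w - v * (u⁻¹ : Bˣ) * b') := by
    linear_combination hbb - (u⁻¹ : Bˣ) * b' * hu + b * b' * u.inv_mul
  have hn : IsCoprime n (f : ℤ) := by
    rcases eq_or_ne f 1 with h1 | h1
    · rw [h1]; exact isCoprime_one_right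
    · refine (((Nat.prime_iff_prime_int.1 (hf.resolve_left h1)).coprime_iff_not_dvd.2 ?_).symm)
      rintro ⟨n', rfl⟩
      push_cast at hnb
      exact hf1 h1 (r * (n' * (u⁻¹ : Bˣ) * b' - (w - v * (u⁻¹ : Bˣ) * b')) + s)
        (by linear_combination r * hnb + hrs')
  obtain ⟨m, l, hml⟩ := hn
  have hml' : (m : B) * n + l * f = 1 := by exact_mod_cast congrArg (Int.cast : ℤ → B) hml
  have huM : algebraMap B K (u⁻¹ : Bˣ) ∈ M := by
    -- Since ub ≡ n and mn ≡ 1 mod f, u⁻¹ ≡ mb mod fB, and fB ⊆ M.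
    have h1 := add_mem (algebraMap_mul_mem (intCast_mem _ m) hb)
      (hfM (l * (u⁻¹ : Bˣ) - m * (u⁻¹ : Bˣ) * v))
    rw [← map_mul, ← map_add] at h1
    convert h1 using 2
    linear_combination -((u⁻¹ : Bˣ) : B) * hml' - m * (u⁻¹ : Bˣ) * hu + m * b * u.inv_mul
  have hMu : M = span A {algebraMap B K (u⁻¹ : Bˣ)} := by
    refine le_antisymm (fun z hz => ?_) ((span_singleton_le_iff_mem _ _).2 huM)
    obtain ⟨c, rfl⟩ := toB z hz
    have h1 : (u : B) * c ∈ A := by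
      have h2 := mul_mem (intCast_mem A (r * n)) (mulO c b' hz hb')
      have h3 : (u : B) * c = ((r * n : ℤ) : B) * (c * b') +
          f * (u * c * (s - r * (w - v * (u⁻¹ : Bˣ) * b'))) := by
        push_cast
        linear_combination -(u : B) * c * hrs' - r * u * c * hnb + r * n * c * b' * u.mul_inv
      rw [h3]
      exact add_mem h2 (natCast_mul_mem_orderOfConductor _)
    have h4 := algebraMap_mul_mem (K := K) h1 (mem_span_singleton_self (R := A)
      (algebraMap B K (u⁻¹ : Bˣ)))
    rwa [← map_mul, mul_right_comm, u.mul_inv, one_mul] at h4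
  refine ⟨x * (Units.map (algebraMap B K : B →* K) u⁻¹), ?_⟩
  have hval : ((X * I₁ : (Submodule A K)ˣ) : Submodule A K) = span A {(x : K)} * M := rfl
  rw [hval, hMu, span_mul_span, Set.singleton_mul_singleton]
  rfl

theorem card_pic_orderOfConductor_eq_iff (K : Type*) [Field K] [Algebra B K] [IsFractionRing B K]
    [IsDedekindDomain B] [Finite (CommRing.Pic B)] (hf : (f : B) ≠ 0) :
    Nat.card (CommRing.Pic B) = Nat.card (CommRing.Pic (orderOfConductor B f)) ↔
      ∀ I : (Submodule (orderOfConductor B f) K)ˣ,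
      (∃ x : Kˣ, extendScalarsHom (orderOfConductor B f) B K I = span B {(x : K)}) →
        ∃ x : Kˣ, (I : Submodule (orderOfConductor B f) K) = span _ {(x : K)} := by
  refine card_pic_eq_iff fun J => ?_
  obtain ⟨x, hx, b, hb⟩ := exists_unit_smul_coprime hf J
  obtain ⟨I, hI⟩ := exists_extendScalarsHom_eq
    (Units.map (spanSingleton B).toMonoidHom x * J) hx b hb
  exact ⟨I, x, hI⟩

end Conductor

theorem map_mem_orderOfConductor_iff {B C : Type*} [CommRing B] [CommRing C] (φ : B ≃+* C) {f : ℕ}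
    {b : B} : φ b ∈ orderOfConductor C f ↔ b ∈ orderOfConductor B f := by
  constructor
  · rintro ⟨a, w, h⟩
    exact ⟨a, φ.symm w, φ.injective (by simpa using h)⟩
  · rintro ⟨a, w, rfl⟩
    exact ⟨a, φ w, by simp⟩

theorem UnitsGenerateModulo.map_ringEquiv {B C : Type*} [CommRing B] [CommRing C] (φ : B ≃+* C)
    {f : ℕ} (h : UnitsGenerateModulo B f) : UnitsGenerateModulo C f := by
  intro c hc
  obtain ⟨u, hu⟩ := h (φ.symm c) (by simpa using hc.map (φ.symm : C →+* B))
  refine ⟨Units.map (φ : B →* C) u, ?_⟩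
  have := (map_mem_orderOfConductor_iff φ).2 hu
  simpa using this

/-! ### Powers of a unit modulo a prime, in coordinates -/

namespace QuadraticAlgebra

variable {e t : ℤ}

theorem mem_orderOfConductor_iff {f : ℕ} {z : QuadraticAlgebra ℤ e t} :
    z ∈ orderOfConductor (QuadraticAlgebra ℤ e t) f ↔ (f : ℤ) ∣ z.im := by
  constructor
  · rintro ⟨a, w, rfl⟩
    exact ⟨w.im, by simp⟩
  · rintro ⟨c, hc⟩
    exact ⟨z.re, ⟨0, c⟩, by ext <;> simp [hc]⟩

/-- If ub = 1 - fv, taking norms gives N(u)N(b) ≡ 1 mod f; conversely N(b) is a multiple of b. -/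
theorem isCoprime_natCast_iff {f : ℕ} {b : QuadraticAlgebra ℤ e t} :
    IsCoprime b (f : QuadraticAlgebra ℤ e t) ↔ IsCoprime b.norm (f : ℤ) := by
  constructor
  · rintro ⟨u, v, h⟩
    have h1 : u * b = ⟨1 - f * v.re, -(f * v.im)⟩ := by
      rw [eq_sub_of_add_eq h]
      ext <;> simp [mul_comm]
    have h2 := congrArg norm h1
    rw [map_mul, norm_def ⟨1 - f * v.re, -(f * v.im)⟩] at h2
    refine ⟨norm u, 2 * v.re - f * v.re ^ 2 + t * (1 - f * v.re) * v.im + e * f * v.im ^ 2, ?_⟩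
    rw [h2]
    dsimp only
    ring
  · rintro ⟨r, s, h⟩
    refine ⟨r * star b, s, ?_⟩
    have h1 := congrArg (algebraMap ℤ (QuadraticAlgebra ℤ e t)) h
    rw [map_add, map_mul, map_mul, algebraMap_norm_eq_mul_star] at h1
    simp only [eq_intCast, Int.cast_natCast, Int.cast_one] at h1
    linear_combination h1

/-- Every element prime to `f` is, up to a power of `η`, in `ℤ + f ℤ[ω]`. -/
def PowersGenerateModulo (η : (QuadraticAlgebra ℤ e t)ˣ) (f : ℕ) : Prop :=
  ∀ b : QuadraticAlgebra ℤ e t, IsCoprime b.norm (f : ℤ) →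
    ∃ k : ℤ, (f : ℤ) ∣ (((η ^ k : (QuadraticAlgebra ℤ e t)ˣ) : QuadraticAlgebra ℤ e t) * b).im

theorem unitsGenerateModulo_iff {η : (QuadraticAlgebra ℤ e t)ˣ}
    (hη : ∀ u : (QuadraticAlgebra ℤ e t)ˣ, ∃ k : ℤ, u = η ^ k ∨ u = -η ^ k) {f : ℕ} :
    UnitsGenerateModulo (QuadraticAlgebra ℤ e t) f ↔ PowersGenerateModulo η f := by
  refine forall_congr' fun b => ?_
  rw [isCoprime_natCast_iff]
  refine imp_congr_right fun _ => ⟨?_, ?_⟩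
  · rintro ⟨u, hu⟩
    rw [mem_orderOfConductor_iff] at hu
    obtain ⟨k, rfl | rfl⟩ := hη u
    · exact ⟨k, hu⟩
    · refine ⟨k, ?_⟩
      rwa [Units.val_neg, neg_mul, im_neg, dvd_neg] at hu
  · rintro ⟨k, hk⟩
    exact ⟨η ^ k, mem_orderOfConductor_iff.2 hk⟩

theorem norm_unit_eq (η : (QuadraticAlgebra ℤ e t)ˣ) :
    norm (η : QuadraticAlgebra ℤ e t) = 1 ∨ norm (η : QuadraticAlgebra ℤ e t) = -1 :=
  Int.isUnit_iff.1 (η.isUnit.map norm)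

theorem unit_inv_mem_orderOfConductor {η : (QuadraticAlgebra ℤ e t)ˣ} {f : ℕ}
    (h : (f : ℤ) ∣ (η : QuadraticAlgebra ℤ e t).im) :
    (f : ℤ) ∣ ((η⁻¹ : (QuadraticAlgebra ℤ e t)ˣ) : QuadraticAlgebra ℤ e t).im := by
  have h1 : ((η⁻¹ : (QuadraticAlgebra ℤ e t)ˣ) : QuadraticAlgebra ℤ e t) =
      algebraMap ℤ _ (norm (η : QuadraticAlgebra ℤ e t)) * star (η : QuadraticAlgebra ℤ e t) := by
    refine Units.inv_eq_of_mul_eq_one_right ?_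
    rw [mul_left_comm, ← algebraMap_norm_eq_mul_star, ← map_mul]
    rcases norm_unit_eq η with h | h <;> simp [h]
  rw [h1]
  simpa using Dvd.dvd.mul_left h _

/-- Here η is a unit of O_f itself, so its powers cannot move an element from outside O_f into it.
-/
theorem not_powersGenerateModulo_of_dvd {η : (QuadraticAlgebra ℤ e t)ˣ} {f : ℕ}
    (h : (f : ℤ) ∣ (η : QuadraticAlgebra ℤ e t).im) {b : QuadraticAlgebra ℤ e t}
    (hb : IsCoprime b.norm (f : ℤ)) (hbf : ¬ (f : ℤ) ∣ b.im) : ¬ PowersGenerateModulo η f := by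
  intro H
  obtain ⟨k, hk⟩ := H b hb
  have hη : η ∈ (orderOfConductor (QuadraticAlgebra ℤ e t) f).toSubmonoid.units :=
    (Submonoid.mem_units_iff _ _).2 ⟨mem_orderOfConductor_iff.2 h,
      mem_orderOfConductor_iff.2 (unit_inv_mem_orderOfConductor h)⟩
  have h1 := ((Submonoid.mem_units_iff _ _).1 (inv_mem (zpow_mem hη k))).1
  have h2 : _ ∈ orderOfConductor (QuadraticAlgebra ℤ e t) f :=
    mul_mem h1 (mem_orderOfConductor_iff.2 hk)
  rw [Units.inv_mul_cancel_left, mem_orderOfConductor_iff] at h2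
  exact hbf h2

/-- With D = t² + 4e, 4N(z) = (2 re + t im)² - D im². For D ≠ 0 mod p this binary form represents
every residue, in particular 4c with c a nonsquare. -/
theorem exists_norm_not_isSquare {p : ℕ} [hp : Fact p.Prime] (hp2 : p ≠ 2)
    (hD : ¬ (p : ℤ) ∣ t ^ 2 + 4 * e) :
    ∃ b : QuadraticAlgebra ℤ e t, ¬ IsSquare ((b.norm : ℤ) : ZMod p) := by
  have h2 : (2 : ZMod p) ≠ 0 := by
    intro h
    have : ((2 : ℕ) : ZMod p) = 0 := by exact_mod_cast h
    rw [ZMod.natCast_eq_zero_iff] at this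
    exact hp2 ((Nat.prime_dvd_prime_iff_eq hp.1 Nat.prime_two).1 this)
  have hD' : (t ^ 2 + 4 * e : ZMod p) ≠ 0 := by
    intro h
    apply hD
    rw [← ZMod.intCast_zmod_eq_zero_iff_dvd]
    push_cast
    exact h
  obtain ⟨c, hc⟩ := FiniteField.exists_nonsquare (F := ZMod p) (by rwa [ZMod.ringChar_zmod_n])
  set D : ZMod p := t ^ 2 + 4 * e with hDdef
  open Polynomial in
  obtain ⟨r, n, hrn⟩ := FiniteField.exists_root_sum_quadratic (R := ZMod p)
    (f := X ^ 2) (g := C (-D) * X ^ 2 - C (4 * c))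
    (degree_X_pow 2) (by compute_degree!) (by
      rw [ZMod.card]; exact (hp.1.eq_two_or_odd).resolve_left hp2)
  simp only [Polynomial.eval_pow, Polynomial.eval_X, Polynomial.eval_sub, Polynomial.eval_mul,
    Polynomial.eval_C] at hrn
  obtain ⟨m', hm'⟩ := ZMod.intCast_surjective ((r - (t : ZMod p) * n) / 2)
  obtain ⟨n', hn'⟩ := ZMod.intCast_surjective n
  refine ⟨⟨m', n'⟩, ?_⟩
  rw [norm_def]
  push_cast
  rw [hm', hn']
  convert hc using 2
  have h4 : (4 : ZMod p) ≠ 0 := by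
    have : (4 : ZMod p) = 2 * 2 := by norm_num
    rw [this]
    exact mul_ne_zero h2 h2
  apply mul_left_cancel₀ h4
  field_simp
  linear_combination hrn + n ^ 2 * hDdef

/-- An element congruent to an integer mod p has square norm mod p, and multiplying by powers of η
preserves the norm; so b of nonsquare norm is never reached. -/
theorem not_powersGenerateModulo_of_norm_eq_one {η : (QuadraticAlgebra ℤ e t)ˣ}
    (hη : norm (η : QuadraticAlgebra ℤ e t) = 1) {p : ℕ} (hp : p.Prime) (hp2 : p ≠ 2)
    (hD : ¬ (p : ℤ) ∣ t ^ 2 + 4 * e) : ¬ PowersGenerateModulo η p := by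
  intro H
  have : Fact p.Prime := ⟨hp⟩
  obtain ⟨b, hb⟩ := exists_norm_not_isSquare hp2 hD
  obtain ⟨k, hk⟩ := H b (((Nat.prime_iff_prime_int.1 hp).coprime_iff_not_dvd.2 fun h => hb (by
    rw [(ZMod.intCast_zmod_eq_zero_iff_dvd _ _).2 h]
    exact IsSquare.zero)).symm)
  set z := ((η ^ k : (QuadraticAlgebra ℤ e t)ˣ) : QuadraticAlgebra ℤ e t) * b with hz
  have hu : Units.map (norm : QuadraticAlgebra ℤ e t →* ℤ) η = 1 := Units.ext hη
  have hk1 : norm ((η ^ k : (QuadraticAlgebra ℤ e t)ˣ) : QuadraticAlgebra ℤ e t) = 1 := by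
    have : Units.map (norm : QuadraticAlgebra ℤ e t →* ℤ) (η ^ k) = 1 := by
      rw [map_zpow, hu, one_zpow]
    exact congrArg Units.val this
  have hN : norm z = norm b := by rw [hz, map_mul, hk1, one_mul]
  apply hb
  rw [← hN, norm_def]
  have h0 := (ZMod.intCast_zmod_eq_zero_iff_dvd _ p).2 hk
  refine ⟨z.re, ?_⟩
  push_cast
  rw [h0]
  ring

theorem isCoprime_norm_iff {p : ℕ} (hp : p.Prime) {z : QuadraticAlgebra ℤ e t} :
    IsCoprime z.norm (p : ℤ) ↔ (z.re * z.re + t * z.re * z.im - e * z.im * z.im : ZMod p) ≠ 0 := by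
  rw [isCoprime_comm, (Nat.prime_iff_prime_int.1 hp).coprime_iff_not_dvd, norm_def,
    ← ZMod.intCast_zmod_eq_zero_iff_dvd _ p]
  push_cast
  rfl

theorem isCoprime_norm_unit (η : (QuadraticAlgebra ℤ e t)ˣ) (f : ℤ) :
    IsCoprime (norm (η : QuadraticAlgebra ℤ e t)) f := by
  rcases norm_unit_eq η with h | h <;> rw [h]
  exacts [isCoprime_one_left, isCoprime_one_left.neg_left]

theorem powersGenerateModulo_two {η : (QuadraticAlgebra ℤ e t)ˣ}
    (h : Odd (η : QuadraticAlgebra ℤ e t).im ∨ (Odd t ∧ Even e)) : PowersGenerateModulo η 2 := by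
  -- The three alternatives are the ω-coordinates of b, ηb and η²b. They suffice because G_2 has
  -- order at most 3.
  have key : ∀ t e x y m n : ZMod 2, x * x + t * x * y - e * y * y ≠ 0 →
      m * m + t * m * n - e * n * n ≠ 0 → (y = 1 ∨ (t = 1 ∧ e = 0)) →
      n = 0 ∨ x * n + y * m + t * y * n = 0 ∨
      x * (x * n + y * m + t * y * n) + y * (x * m + e * y * n) +
        t * y * (x * n + y * m + t * y * n) = 0 := by
    decide
  intro b hb
  have hη := (isCoprime_norm_iff Nat.prime_two).1 (isCoprime_norm_unit η _)
  have hb' := (isCoprime_norm_iff Nat.prime_two).1 hb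
  simp only [← ZMod.intCast_eq_one_iff_odd, ← ZMod.intCast_eq_zero_iff_even] at h
  simp only [← ZMod.intCast_zmod_eq_zero_iff_dvd]
  rcases key _ _ _ _ _ _ hη hb' h with h0 | h1 | h2
  · exact ⟨0, by simpa using h0⟩
  · refine ⟨1, ?_⟩
    rw [← h1, zpow_one, im_mul]
    push_cast
    ring
  · refine ⟨2, ?_⟩
    rw [← h2, zpow_two, Units.val_mul, mul_assoc]
    simp only [im_mul, re_mul]
    push_cast
    ring

/-- G_3 has order 2 if 3 splits and is cyclic of order 4 if 3 is inert; norm -1 makes η a generator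
in both cases. If 3 ramifies, norms of units are squares mod 3, so -1 does not occur. Exponents 0,
1, 2, -1 cover G_3. -/
theorem powersGenerateModulo_three {η : (QuadraticAlgebra ℤ e t)ˣ}
    (h : norm (η : QuadraticAlgebra ℤ e t) = -1) : PowersGenerateModulo η 3 := by
  have key : ∀ t e x y m n : ZMod 3, x * x + t * x * y - e * y * y = -1 →
      m * m + t * m * n - e * n * n ≠ 0 →
      n = 0 ∨ x * n + y * m + t * y * n = 0 ∨
      x * (x * n + y * m + t * y * n) + y * (x * m + e * y * n) +
        t * y * (x * n + y * m + t * y * n) = 0 ∨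
      y * m - x * n = 0 := by
    decide
  intro b hb
  have hη : ((η : QuadraticAlgebra ℤ e t).re * (η : QuadraticAlgebra ℤ e t).re +
      t * (η : QuadraticAlgebra ℤ e t).re * (η : QuadraticAlgebra ℤ e t).im -
      e * (η : QuadraticAlgebra ℤ e t).im * (η : QuadraticAlgebra ℤ e t).im : ZMod 3) = -1 := by
    rw [norm_def] at h
    exact_mod_cast congrArg (Int.cast : ℤ → ZMod 3) h
  have hinv : ((η⁻¹ : (QuadraticAlgebra ℤ e t)ˣ) : QuadraticAlgebra ℤ e t) =
      -star (η : QuadraticAlgebra ℤ e t) := by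
    refine Units.inv_eq_of_mul_eq_one_right ?_
    rw [mul_neg, ← algebraMap_norm_eq_mul_star, h]
    simp
  have hb' := (isCoprime_norm_iff Nat.prime_three).1 hb
  simp only [← ZMod.intCast_zmod_eq_zero_iff_dvd]
  rcases key _ _ _ _ _ _ hη hb' with h0 | h1 | h2 | h3
  · exact ⟨0, by simpa using h0⟩
  · refine ⟨1, ?_⟩
    rw [← h1, zpow_one, im_mul]
    push_cast
    ring
  · refine ⟨2, ?_⟩
    rw [← h2, zpow_two, Units.val_mul, mul_assoc]
    simp only [im_mul, re_mul]
    push_cast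
    ring
  · refine ⟨-1, ?_⟩
    rw [← h3, zpow_neg_one, hinv]
    simp only [im_mul, im_neg, re_neg, re_star, im_star]
    push_cast
    ring

/-- Mod p the square root of D is nilpotent, so I/T (ω-coordinate over trace) acts as a logarithm
from G_p to the additive group of `ZMod p`. As its value at η is nonzero, its multiples reach every
residue. -/
theorem powersGenerateModulo_of_ramified {η : (QuadraticAlgebra ℤ e t)ˣ} {p : ℕ} (hp : p.Prime)
    (hp2 : p ≠ 2) (hD : (p : ℤ) ∣ t ^ 2 + 4 * e) (h : ¬ (p : ℤ) ∣ (η : QuadraticAlgebra ℤ e t).im) :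
    PowersGenerateModulo η p := by
  have : Fact p.Prime := ⟨hp⟩
  have h2 : (2 : ZMod p) ≠ 0 := by
    intro h
    have : ((2 : ℕ) : ZMod p) = 0 := by exact_mod_cast h
    rw [ZMod.natCast_eq_zero_iff] at this
    exact hp2 ((Nat.prime_dvd_prime_iff_eq hp Nat.prime_two).1 this)
  have hD0 : (t ^ 2 + 4 * e : ZMod p) = 0 := by
    have := (ZMod.intCast_zmod_eq_zero_iff_dvd _ p).2 hD
    exact_mod_cast this
  let I : QuadraticAlgebra ℤ e t → ZMod p := fun z => (z.im : ZMod p)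
  let T : QuadraticAlgebra ℤ e t → ZMod p := fun z => 2 * z.re + t * z.im
  have hT : ∀ z, IsCoprime (norm z) (p : ℤ) → T z ≠ 0 := by
    intro z hz h0
    refine (isCoprime_norm_iff hp).1 hz ?_
    have h4 : (2 * 2 : ZMod p) ≠ 0 := mul_ne_zero h2 h2
    apply (mul_eq_zero.1 (?_ : (2 * 2 : ZMod p) * _ = 0)).resolve_left h4
    linear_combination T z * h0 - (z.im : ZMod p) ^ 2 * hD0
  have hImul : ∀ z w, 2 * I (z * w) = I z * T w + I w * T z := by
    intro z w
    simp only [I, T, im_mul]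
    push_cast
    ring
  have hTmul : ∀ z w, 2 * T (z * w) = T z * T w := by
    intro z w
    simp only [T, re_mul, im_mul]
    push_cast
    linear_combination (z.im : ZMod p) * w.im * hD0
  intro b hb
  have hη := hT _ (isCoprime_norm_unit η _)
  have hb' := hT _ hb
  have hI : I (η : QuadraticAlgebra ℤ e t) ≠ 0 :=
    fun h0 => h ((ZMod.intCast_zmod_eq_zero_iff_dvd _ p).1 h0)
  -- This is I/T(ηᵏb) = k·I/T(η) + I/T(b) with denominators cleared.
  have key : ∀ k : ℕ, T ((η : QuadraticAlgebra ℤ e t) ^ k * b) ≠ 0 ∧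
      I ((η : QuadraticAlgebra ℤ e t) ^ k * b) * (T η * T b) =
        T ((η : QuadraticAlgebra ℤ e t) ^ k * b) * (k * I η * T b + I b * T η) := by
    intro k
    induction k with
    | zero =>
      refine ⟨by simpa using hb', ?_⟩
      simp only [pow_zero, one_mul, Nat.cast_zero]
      ring
    | succ k ih =>
      obtain ⟨ih1, ih2⟩ := ih
      have hI' := hImul η ((η : QuadraticAlgebra ℤ e t) ^ k * b)
      have hT' := hTmul η ((η : QuadraticAlgebra ℤ e t) ^ k * b)
      rw [← mul_assoc, ← pow_succ'] at hI' hT'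
      refine ⟨fun h0 => mul_ne_zero hη ih1 (by rw [← hT', h0, mul_zero]), ?_⟩
      apply mul_left_cancel₀ h2
      push_cast
      linear_combination (T η * T b) * hI' + T η * ih2 -
        ((k + 1) * I η * T b + I b * T η) * hT'
  obtain ⟨k, hk⟩ := ZMod.natCast_zmod_surjective (-(I b * T η) / (I η * T b))
  refine ⟨k, (ZMod.intCast_zmod_eq_zero_iff_dvd _ p).1 ?_⟩
  have h3 := (key k).2
  have h4 : (k : ZMod p) * I η * T b + I b * T η = 0 := by
    rw [hk]
    field_simp
    ring
  rw [h4, mul_zero] at h3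
  rw [zpow_natCast, Units.val_pow_eq_pow_val]
  exact (mul_eq_zero.1 h3).resolve_right (mul_ne_zero hη hb')

end QuadraticAlgebra

/-! ### The ring of integers of ℚ(√d) -/

section RealQuadField

theorem Rat.exists_int_of_squarefree_mul_sq {d : ℕ} (hsq : Squarefree d) {q : ℚ} {c : ℤ}
    (h : d * q ^ 2 = c) : ∃ b : ℤ, q = b := by
  have hden : (q.den : ℚ) ≠ 0 := by exact_mod_cast q.den_ne_zero
  have h1 : (d : ℤ) * q.num ^ 2 = c * (q.den : ℤ) ^ 2 := by
    have : (d : ℚ) * q.num ^ 2 = c * (q.den : ℚ) ^ 2 := by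
      rw [← h, mul_assoc, ← mul_pow, Rat.mul_den_eq_num]
    exact_mod_cast this
  have h2 : (d : ℤ).natAbs * q.num.natAbs ^ 2 = c.natAbs * q.den ^ 2 := by
    have := congrArg Int.natAbs h1
    simpa [Int.natAbs_mul, Int.natAbs_pow] using this
  have h3 : q.den ^ 2 ∣ d :=
    (Nat.Coprime.pow 2 2 q.reduced.symm).dvd_of_dvd_mul_right ⟨c.natAbs, by
      rw [Int.natAbs_natCast] at h2; rw [h2, mul_comm]⟩
  have h4 : q.den = 1 := Nat.isUnit_iff.1 (hsq _ (by rwa [← pow_two]))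
  exact ⟨q.num, ((Rat.den_eq_one_iff q).1 h4).symm⟩

theorem exists_int_coords {d : ℕ} (hsq : Squarefree d) {r s : ℚ} {a N : ℤ} (ha : 2 * r = a)
    (hN : r ^ 2 - d * s ^ 2 = N) :
    ∃ m n : ℤ, if d % 4 = 1 then r = m + n / 2 ∧ s = n / 2 else r = m ∧ s = n := by
  obtain ⟨b, hb⟩ : ∃ b : ℤ, 2 * s = b :=
    Rat.exists_int_of_squarefree_mul_sq hsq (c := a ^ 2 - 4 * N) (by
      push_cast
      rw [← ha, ← hN]
      ring)
  have hr : r = a / 2 := by linarith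
  have hs : s = b / 2 := by linarith
  subst hr hs
  have hab : a ^ 2 - d * b ^ 2 = 4 * N := by
    have : (a : ℚ) ^ 2 - d * b ^ 2 = 4 * N := by linarith
    exact_mod_cast this
  have hd0 : d % 4 ≠ 0 := by
    intro h
    have := hsq 2 (Nat.dvd_of_mod_eq_zero h)
    simp at this
  have hmod : (a : ZMod 4) ^ 2 - d * (b : ZMod 4) ^ 2 = 0 := by
    have := congrArg (Int.cast : ℤ → ZMod 4) hab
    push_cast at this
    rw [this]
    have : (4 : ZMod 4) = 0 := rfl
    rw [this, zero_mul]
  split_ifs with h1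
  · have hd1 : (d : ZMod 4) = 1 := by
      rw [← Nat.cast_one, ZMod.natCast_eq_natCast_iff', h1]
    rw [hd1] at hmod
    have key : ∀ a b : ZMod 4, a ^ 2 - 1 * b ^ 2 = 0 → 2 * (a - b) = 0 := by decide
    have h2 := key _ _ hmod
    have h3 : ((4 : ℕ) : ℤ) ∣ 2 * (a - b) := by
      rw [← ZMod.intCast_zmod_eq_zero_iff_dvd _ 4]
      exact_mod_cast h2
    obtain ⟨m, hm⟩ : (2 : ℤ) ∣ a - b := by omega
    refine ⟨m, b, ?_, rfl⟩
    have : (a : ℚ) - b = 2 * m := by exact_mod_cast hm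
    linarith
  · have key : ∀ D a b : ZMod 4, D ≠ 0 → D ≠ 1 → a ^ 2 - D * b ^ 2 = 0 →
        2 * a = 0 ∧ 2 * b = 0 := by decide
    have hD0 : (d : ZMod 4) ≠ 0 := by
      rw [Ne, ZMod.natCast_eq_zero_iff]
      omega
    have hD1 : (d : ZMod 4) ≠ 1 := by
      rw [← Nat.cast_one, Ne, ZMod.natCast_eq_natCast_iff']
      omega
    obtain ⟨h2, h3⟩ := key _ _ _ hD0 hD1 hmod
    have h4 : ((4 : ℕ) : ℤ) ∣ 2 * a := by
      rw [← ZMod.intCast_zmod_eq_zero_iff_dvd _ 4]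
      exact_mod_cast h2
    have h5 : ((4 : ℕ) : ℤ) ∣ 2 * b := by
      rw [← ZMod.intCast_zmod_eq_zero_iff_dvd _ 4]
      exact_mod_cast h3
    obtain ⟨m, rfl⟩ : (2 : ℤ) ∣ a := by omega
    obtain ⟨n, rfl⟩ : (2 : ℤ) ∣ b := by omega
    exact ⟨m, n, by push_cast; ring, by push_cast; ring⟩

/-- The field `ℚ(√d)` as a quadratic algebra. -/
theorem exists_algEquiv_realQuadField {d : ℕ} (hd : 2 ≤ d) (hsq : Squarefree d) :
    ∃ Ψ : QuadraticAlgebra ℚ d 0 ≃ₐ[ℚ] RealQuadField d,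
      ∀ z, ((Ψ z : RealQuadField d) : ℝ) = z.re + z.im * √d := by
  -- Irrationality of √d makes the quadratic algebra a field, which gives injectivity of `F` below.
  have : Fact (∀ r : ℚ, r ^ 2 ≠ d + 0 * r) := ⟨fun r hr => by
    obtain ⟨b, rfl⟩ := Rat.exists_int_of_squarefree_mul_sq (d := 1) squarefree_one
      (q := r) (c := d) (by push_cast; rw [hr]; ring)
    have hb : (b : ℚ) * b = d := by rw [← pow_two, hr]; ring
    have hb' : b.natAbs * b.natAbs = d := by
      zify
      rw [abs_mul_abs_self]
      exact_mod_cast hb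
    have := Nat.isUnit_iff.1 (hsq b.natAbs (dvd_of_eq hb'))
    rw [this] at hb'
    omega⟩
  have hd0 : (0 : ℝ) ≤ d := Nat.cast_nonneg d
  let α : RealQuadField d :=
    ⟨√d, IntermediateField.subset_adjoin ℚ _ (Set.mem_singleton _)⟩
  have hα : α * α = (d : ℚ) • (1 : RealQuadField d) + (0 : ℚ) • α := by
    apply Subtype.ext
    simp [α, Algebra.smul_def, hd0]
  let F : QuadraticAlgebra ℚ d 0 →ₐ[ℚ] RealQuadField d := QuadraticAlgebra.lift ⟨α, hα⟩
  have hF : ∀ z, ((F z : RealQuadField d) : ℝ) = z.re + z.im * √d := by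
    intro z
    change ((z.re • (1 : RealQuadField d) + z.im • α : RealQuadField d) : ℝ) = _
    simp [α, Algebra.smul_def]
  have hsurj : Function.Surjective F := by
    have hle : RealQuadField d ≤ ((RealQuadField d).val.comp F).fieldRange := by
      rw [IntermediateField.adjoin_simple_le_iff]
      exact ⟨⟨0, 1⟩, (hF ⟨0, 1⟩).trans (by simp)⟩
    intro z
    obtain ⟨w, hw⟩ := hle z.2
    exact ⟨w, Subtype.ext hw⟩
  exact ⟨AlgEquiv.ofBijective F ⟨(F : QuadraticAlgebra ℚ d 0 →+* RealQuadField d).injective, hsurj⟩,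
    hF⟩

theorem norm_quadraticAlgebra (d : ℚ) (z : QuadraticAlgebra ℚ d 0) :
    Algebra.norm ℚ z = z.norm := by
  rw [Algebra.norm_apply, ← QuadraticAlgebra.det_toLinearMap_eq_norm]
  rfl

/-- Trace and norm of an integral element are integral rationals, hence integers; the rest is
arithmetic mod 4. -/
theorem exists_int_coords_of_isIntegral {d : ℕ} (hsq : Squarefree d) {z : QuadraticAlgebra ℚ d 0}
    (hz : IsIntegral ℤ z) :
    ∃ m n : ℤ, if d % 4 = 1 then z.re = m + n / 2 ∧ z.im = n / 2 else z.re = m ∧ z.im = n := by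
  have hz' : IsIntegral ℤ (star z) :=
    hz.map (starRingEnd (QuadraticAlgebra ℚ (d : ℚ) 0)).toIntAlgHom
  have h1 : IsIntegral ℤ (algebraMap ℚ (QuadraticAlgebra ℚ (d : ℚ) 0) (2 * z.re)) := by
    convert hz.add hz' using 1
    ext <;> simp [two_mul]
  have h2 : IsIntegral ℤ (algebraMap ℚ (QuadraticAlgebra ℚ (d : ℚ) 0) z.norm) := by
    rw [QuadraticAlgebra.algebraMap_norm_eq_mul_star]
    exact hz.mul hz'
  rw [isIntegral_algebraMap_iff QuadraticAlgebra.algebraMap_injective,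
    IsIntegrallyClosed.isIntegral_iff] at h1 h2
  obtain ⟨a, ha⟩ := h1
  obtain ⟨N, hN⟩ := h2
  refine exists_int_coords hsq (a := a) (N := N) (by simpa using ha.symm) ?_
  rw [QuadraticAlgebra.norm_def] at hN
  simp only [eq_intCast] at hN
  rw [hN]
  ring

/-- Serves both residue cases, with ω = t/2 + c√d; the relation `h` says that ω is a root of X² - tX
- e. -/
theorem exists_ringEquiv_ringOfIntegers {d : ℕ} (hd : 2 ≤ d) (hsq : Squarefree d) {e t : ℤ} {c : ℚ}
    (hc : c ≠ 0) (h : 4 * c ^ 2 * d = t ^ 2 + 4 * e)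
    (hcoord : ∀ z : QuadraticAlgebra ℚ d 0, IsIntegral ℤ z →
      ∃ m n : ℤ, z.re = m + t / 2 * n ∧ z.im = c * n) :
    ∃ φ : QuadraticAlgebra ℤ e t ≃+* 𝓞 (RealQuadField d),
      (∀ z, (((φ z : 𝓞 (RealQuadField d)) : RealQuadField d) : ℝ) =
        z.re + z.im * (t / 2 + c * √d)) ∧
      ∀ z, Algebra.norm ℚ ((φ z : 𝓞 (RealQuadField d)) : RealQuadField d) = (z.norm : ℤ) := by
  obtain ⟨Ψ, hΨ⟩ := exists_algEquiv_realQuadField hd hsq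
  let w : QuadraticAlgebra ℚ d 0 := ⟨t / 2, c⟩
  have hw : w * w = (e : QuadraticAlgebra ℚ d 0) + (t : QuadraticAlgebra ℚ d 0) * w := by
    ext
    · simp only [w, QuadraticAlgebra.re_mul, QuadraticAlgebra.re_add, QuadraticAlgebra.re_intCast,
        QuadraticAlgebra.im_intCast]
      linear_combination h / 4
    · simp only [w, QuadraticAlgebra.im_mul, QuadraticAlgebra.im_add, QuadraticAlgebra.re_intCast,
        QuadraticAlgebra.im_intCast]
      ring
  have hΨw : Ψ w * Ψ w = (e : RealQuadField d) + t * Ψ w := by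
    rw [← map_mul, hw, map_add, map_mul, map_intCast, map_intCast]
  have hint : IsIntegral ℤ (Ψ w) := by
    refine ⟨Polynomial.X ^ 2 - (Polynomial.C t * Polynomial.X + Polynomial.C e),
      Polynomial.monic_X_pow_sub (by compute_degree!), ?_⟩
    simp only [Polynomial.eval₂_sub, Polynomial.eval₂_add, Polynomial.eval₂_mul,
      Polynomial.eval₂_pow, Polynomial.eval₂_X, Polynomial.eval₂_C]
    simp only [eq_intCast]
    linear_combination hΨw
  obtain ⟨ω, hωw⟩ : ∃ ω : 𝓞 (RealQuadField d), (ω : RealQuadField d) = Ψ w := ⟨⟨Ψ w, hint⟩, rfl⟩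
  have hω : ω * ω = e • (1 : 𝓞 (RealQuadField d)) + t • ω := by
    apply NumberField.RingOfIntegers.ext
    simpa [hωw] using hΨw
  let ψ : QuadraticAlgebra ℤ e t →ₐ[ℤ] 𝓞 (RealQuadField d) := QuadraticAlgebra.lift ⟨ω, hω⟩
  have hψ : ∀ z, ((ψ z : 𝓞 (RealQuadField d)) : RealQuadField d) =
      Ψ ⟨z.re + t / 2 * z.im, c * z.im⟩ := by
    intro z
    have h1 : ψ z = z.re • (1 : 𝓞 (RealQuadField d)) + z.im • ω := rfl
    have h2 : (⟨z.re + t / 2 * z.im, c * z.im⟩ : QuadraticAlgebra ℚ d 0) =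
        z.re + z.im * w := by
      ext
      · simp [w, mul_comm]
      · simp [w, mul_comm]
    rw [h1, h2]
    simp [hωw]
  have hbij : Function.Bijective ψ := by
    constructor
    · rw [injective_iff_map_eq_zero]
      intro z hz
      have h1 := (hψ z).symm
      rw [hz] at h1
      replace h1 := (map_eq_zero_iff _ Ψ.injective).1
        (h1.trans (map_zero (algebraMap (𝓞 (RealQuadField d)) (RealQuadField d))))
      have him : z.im = 0 := by
        have := congrArg QuadraticAlgebra.im h1
        simpa [hc] using this
      have hre : z.re = 0 := by
        have := congrArg QuadraticAlgebra.re h1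
        simpa [him] using this
      exact QuadraticAlgebra.ext hre him
    · intro z
      have hz : IsIntegral ℤ (Ψ.symm (z : RealQuadField d)) :=
        (NumberField.RingOfIntegers.isIntegral_coe z).map
          (Ψ.symm : RealQuadField d →+* QuadraticAlgebra ℚ (d : ℚ) 0).toIntAlgHom
      obtain ⟨m, n, hm, hn⟩ := hcoord _ hz
      refine ⟨⟨m, n⟩, NumberField.RingOfIntegers.ext ?_⟩
      rw [hψ, ← AlgEquiv.eq_symm_apply]
      exact QuadraticAlgebra.ext hm.symm hn.symm
  refine ⟨RingEquiv.ofBijective ψ hbij, fun z => ?_, fun z => ?_⟩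
  · change (((ψ z : 𝓞 (RealQuadField d)) : RealQuadField d) : ℝ) = _
    rw [hψ, hΨ]
    push_cast
    ring
  · change Algebra.norm ℚ ((ψ z : 𝓞 (RealQuadField d)) : RealQuadField d) = _
    rw [hψ, Algebra.norm_eq_of_algEquiv, norm_quadraticAlgebra, QuadraticAlgebra.norm_def,
      QuadraticAlgebra.norm_def]
    push_cast
    linear_combination -(z.im : ℚ) ^ 2 / 4 * h

/-- The ring of integers of `ℚ(√d)` is `ℤ[ω]`. -/
theorem exists_ringEquiv_quadOmega {d : ℕ} (hd : 2 ≤ d) (hsq : Squarefree d) :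
    ∃ e t : ℤ, (d % 4 = 1 ∧ t = 1 ∧ 4 * e + 1 = d ∨ d % 4 ≠ 1 ∧ t = 0 ∧ e = d) ∧
    ∃ φ : QuadraticAlgebra ℤ e t ≃+* 𝓞 (RealQuadField d),
      (∀ z, (((φ z : 𝓞 (RealQuadField d)) : RealQuadField d) : ℝ) = z.re + z.im * quadOmega d) ∧
      ∀ z, Algebra.norm ℚ ((φ z : 𝓞 (RealQuadField d)) : RealQuadField d) = (z.norm : ℤ) := by
  by_cases h1 : d % 4 = 1
  · obtain ⟨e, he⟩ : ∃ e : ℤ, 4 * e + 1 = d := ⟨d / 4, by omega⟩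
    refine ⟨e, 1, Or.inl ⟨h1, rfl, he⟩, ?_⟩
    have he' : (4 * e + 1 : ℚ) = d := by exact_mod_cast he
    obtain ⟨φ, hφ, hN⟩ := exists_ringEquiv_ringOfIntegers hd hsq (e := e) (t := 1) (c := 1 / 2)
      (by norm_num) (by push_cast; linear_combination -he') (fun z hz => by
        obtain ⟨m, n, hmn⟩ := exists_int_coords_of_isIntegral hsq hz
        rw [if_pos h1] at hmn
        exact ⟨m, n, by rw [hmn.1]; push_cast; ring, by rw [hmn.2]; ring⟩)
    refine ⟨φ, fun z => ?_, hN⟩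
    rw [hφ, quadOmega, if_pos h1]
    push_cast
    ring
  · refine ⟨d, 0, Or.inr ⟨h1, rfl, rfl⟩, ?_⟩
    obtain ⟨φ, hφ, hN⟩ := exists_ringEquiv_ringOfIntegers hd hsq (e := d) (t := 0) (c := 1)
      one_ne_zero (by push_cast; ring) (fun z hz => by
        obtain ⟨m, n, hmn⟩ := exists_int_coords_of_isIntegral hsq hz
        rw [if_neg h1] at hmn
        exact ⟨m, n, by rw [hmn.1]; push_cast; ring, by rw [hmn.2]; ring⟩)
    refine ⟨φ, fun z => ?_, hN⟩
    rw [hφ, quadOmega, if_neg h1]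
    push_cast
    ring

end RealQuadField

/-! ### Reduction of (RC) to primes, and conclusion -/

theorem numberField_realQuadField {d : ℕ} (hd : 2 ≤ d) (hsq : Squarefree d) :
    NumberField (RealQuadField d) := by
  obtain ⟨Ψ, -⟩ := exists_algEquiv_realQuadField hd hsq
  have : FiniteDimensional ℚ (RealQuadField d) := Module.Finite.equiv Ψ.toLinearEquiv
  exact { to_charZero := inferInstance, to_finiteDimensional := inferInstance }

theorem satisfiesRC_iff {d : ℕ} (hd : 2 ≤ d) (hsq : Squarefree d) {e t : ℤ}
    (φ : QuadraticAlgebra ℤ e t ≃+* 𝓞 (RealQuadField d)) {η : (QuadraticAlgebra ℤ e t)ˣ}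
    (hη : ∀ u : (QuadraticAlgebra ℤ e t)ˣ, ∃ k : ℤ, u = η ^ k ∨ u = -η ^ k) :
    SatisfiesRC d ↔ ∀ p : ℕ, p.Prime → ¬ QuadraticAlgebra.PowersGenerateModulo η p := by
  have := numberField_realQuadField hd hsq
  have hfin : Finite (CommRing.Pic (𝓞 (RealQuadField d))) :=
    Finite.of_equiv _ (ClassGroup.equivPic (𝓞 (RealQuadField d))).toEquiv
  have hPG : ∀ f, UnitsGenerateModulo (𝓞 (RealQuadField d)) f ↔
      QuadraticAlgebra.PowersGenerateModulo η f := fun f => by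
    rw [← QuadraticAlgebra.unitsGenerateModulo_iff hη]
    exact ⟨fun h => h.map_ringEquiv φ.symm, fun h => h.map_ringEquiv φ⟩
  have hcard : ∀ f : ℕ, 0 < f → _ := fun f hf =>
    card_pic_orderOfConductor_eq_iff (B := 𝓞 (RealQuadField d)) (f := f) (RealQuadField d)
      (Nat.cast_ne_zero.2 hf.ne')
  have hto : ∀ f : ℕ, 0 < f → quadClassNumber d =
      Nat.card (CommRing.Pic (orderOfConductor (𝓞 (RealQuadField d)) f)) →
        UnitsGenerateModulo (𝓞 (RealQuadField d)) f := fun f hf h =>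
    unitsGenerateModulo_of_principal ((hcard f hf).1 h)
  have hof : ∀ f : ℕ, f = 1 ∨ f.Prime → UnitsGenerateModulo (𝓞 (RealQuadField d)) f →
      quadClassNumber d =
        Nat.card (CommRing.Pic (orderOfConductor (𝓞 (RealQuadField d)) f)) := by
    intro f hf h
    have hf0 : 0 < f := by
      rcases hf with rfl | hf
      exacts [one_pos, hf.pos]
    refine (hcard f hf0).2 (principal_of_unitsGenerateModulo hf (fun hf1 w hw => ?_) h)
    have h1 := congrArg QuadraticAlgebra.re (congrArg φ.symm hw)
    rw [map_mul, map_natCast, map_one] at h1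
    have h2 : (f : ℤ) * (φ.symm w).re = 1 := by simpa [QuadraticAlgebra.re_one] using h1
    exact hf1 (by simpa using Int.isUnit_iff_natAbs_eq.1 (IsUnit.of_mul_eq_one _ h2))
  rw [SatisfiesRC, Set.eq_singleton_iff_unique_mem]
  constructor
  · rintro ⟨-, h⟩ p hp hpg
    exact hp.ne_one (h p ⟨hp.pos, hof p (Or.inr hp) ((hPG p).2 hpg)⟩)
  · intro h
    refine ⟨⟨one_pos, hof 1 (Or.inl rfl) ((hPG 1).2 fun b _ => ⟨0, by simp⟩)⟩, ?_⟩
    rintro f ⟨hf, hc⟩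
    by_contra hf1
    obtain ⟨p, hp, hpf⟩ := Nat.exists_prime_and_dvd hf1
    exact h p hp ((hPG p).1 ((hto f hf hc).of_prime_dvd hf.ne' hp hpf))

theorem Squarefree.dvd_of_forall_prime {d y : ℕ} (hsq : Squarefree d)
    (h : ∀ p : ℕ, p.Prime → p ∣ d → p ∣ y) : d ∣ y := by
  rw [← Nat.prod_primeFactors_of_squarefree hsq]
  exact Finset.prod_primes_dvd _ (fun p hp => (Nat.prime_of_mem_primeFactors hp).prime)
    fun p hp => h p (Nat.prime_of_mem_primeFactors hp) (Nat.dvd_of_mem_primeFactors hp)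

open QuadraticAlgebra in
theorem forall_not_powersGenerateModulo_iff {d : ℕ} (hsq : Squarefree d) {e t : ℤ}
    (het : d % 4 = 1 ∧ t = 1 ∧ 4 * e + 1 = d ∨ d % 4 ≠ 1 ∧ t = 0 ∧ e = d)
    {η : (QuadraticAlgebra ℤ e t)ˣ} {y : ℕ} (hy : (η : QuadraticAlgebra ℤ e t).im = y) :
    (∀ p : ℕ, p.Prime → ¬ PowersGenerateModulo η p) ↔
      norm (η : QuadraticAlgebra ℤ e t) = 1 ∧ ¬ d ≡ 1 [MOD 8] ∧ Even y ∧ d ∣ y := by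
  have hD : t ^ 2 + 4 * e = d ∨ t ^ 2 + 4 * e = 4 * d := by
    rcases het with ⟨-, rfl, h⟩ | ⟨-, rfl, rfl⟩
    · left; linarith
    · right; ring
  constructor
  · intro h
    have hev : Even y := by
      rw [← Nat.not_odd_iff_even]
      intro hodd
      exact h 2 Nat.prime_two (powersGenerateModulo_two (Or.inl (by rw [hy]; exact_mod_cast hodd)))
    refine ⟨(norm_unit_eq η).resolve_right fun h1 =>
      h 3 Nat.prime_three (powersGenerateModulo_three h1), fun h8 => ?_, hev, ?_⟩
    · have h8' : d % 8 = 1 := h8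
      refine h 2 Nat.prime_two (powersGenerateModulo_two (Or.inr ?_))
      rcases het with ⟨-, rfl, h1⟩ | ⟨h1, -⟩
      · exact ⟨odd_one, by rw [Int.even_iff]; omega⟩
      · omega
    · refine hsq.dvd_of_forall_prime fun p hp hpd => ?_
      rcases eq_or_ne p 2 with rfl | hp2
      · exact hev.two_dvd
      · by_contra hpy
        refine h p hp (powersGenerateModulo_of_ramified hp hp2 ?_ ?_)
        · have : (p : ℤ) ∣ d := by exact_mod_cast hpd
          rcases hD with h | h <;> rw [h]
          exacts [this, this.mul_left _]
        · rw [hy]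
          exact_mod_cast hpy
  · rintro ⟨hN, h8, hev, hdy⟩ p hp
    rcases eq_or_ne p 2 with rfl | hp2
    · have h2 : ((2 : ℕ) : ℤ) ∣ (η : QuadraticAlgebra ℤ e t).im := by
        rw [hy]
        exact_mod_cast hev.two_dvd
      rcases Int.even_or_odd e with he | he
      · have ht : t = 0 := by
          rcases het with ⟨-, -, h1⟩ | ⟨-, h1, -⟩
          · refine absurd (?_ : d % 8 = 1) h8
            obtain ⟨k, rfl⟩ := he
            omega
          · exact h1
        -- The element 1 + ω has norm 1 - e, which is odd.
        refine not_powersGenerateModulo_of_dvd h2 (b := ⟨1, 1⟩) ?_ (by norm_num)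
        rw [norm_def, ht]
        obtain ⟨k, rfl⟩ := he
        exact ⟨1, k, by push_cast; ring⟩
      · refine not_powersGenerateModulo_of_dvd h2 (b := ⟨0, 1⟩) ?_ (by norm_num)
        rw [norm_def]
        obtain ⟨k, rfl⟩ := he
        exact ⟨1, k + 1, by push_cast; ring⟩
    · by_cases hpD : (p : ℤ) ∣ t ^ 2 + 4 * e
      · have hp2' : ¬ (p : ℤ) ∣ 2 := fun h2 =>
          hp2 ((Nat.prime_dvd_prime_iff_eq hp Nat.prime_two).1 (by exact_mod_cast h2))
        have hpd : (p : ℤ) ∣ d := by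
          rcases hD with h | h <;> rw [h] at hpD
          · exact hpD
          · refine ((Nat.prime_iff_prime_int.1 hp).dvd_or_dvd hpD).resolve_left fun h4 => ?_
            rw [show (4 : ℤ) = 2 * 2 by norm_num] at h4
            exact hp2' ((or_self_iff).1 ((Nat.prime_iff_prime_int.1 hp).dvd_or_dvd h4))
        have hpy : (p : ℤ) ∣ (η : QuadraticAlgebra ℤ e t).im := by
          rw [hy]
          exact hpd.trans (by exact_mod_cast hdy)
        -- This is 1 + √D, where √D = 2ω - t and D = t² + 4e; its norm 1 - D is 1 mod p.
        refine not_powersGenerateModulo_of_dvd hpy (b := ⟨1 - t, 2⟩) ?_ hp2'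
        obtain ⟨k, hk⟩ := hpD
        rw [norm_def]
        exact ⟨1, k, by linear_combination -hk⟩
      · exact not_powersGenerateModulo_of_norm_eq_one hN hp hp2 hpD

theorem proposition2p2 (d : ℕ) (hd : 2 ≤ d) (hsq : Squarefree d)
    (ε : (𝓞 (RealQuadField d))ˣ) (hε : IsFundamentalUnit d ε)
    (x y : ℕ)
    (hxy : (((ε : 𝓞 (RealQuadField d)) : RealQuadField d) : ℝ) = x + y * quadOmega d) :
    SatisfiesRC d ↔
      Algebra.norm ℚ ((ε : 𝓞 (RealQuadField d)) : RealQuadField d) = 1 ∧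
        ¬ d ≡ 1 [MOD 8] ∧ Even y ∧ d ∣ y := by
  obtain ⟨e, t, het, φ, hφ, hN⟩ := exists_ringEquiv_quadOmega hd hsq
  let Φ : (QuadraticAlgebra ℤ e t)ˣ ≃* (𝓞 (RealQuadField d))ˣ := Units.mapEquiv φ.toMulEquiv
  obtain ⟨η, rfl⟩ := Φ.surjective ε
  have hval : ((Φ η : (𝓞 (RealQuadField d))ˣ) : 𝓞 (RealQuadField d)) = φ η := rfl
  rw [hval] at hxy ⊢
  have hη : ∀ u : (QuadraticAlgebra ℤ e t)ˣ, ∃ k : ℤ, u = η ^ k ∨ u = -η ^ k := by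
    intro u
    obtain ⟨k, hk⟩ := hε.2 (Φ u)
    refine ⟨k, hk.imp (fun h => Φ.injective (by rw [h, map_zpow])) fun h => Φ.injective ?_⟩
    rw [h, ← map_zpow]
    ext1
    exact (map_neg φ _).symm
  have hη_eq : (η : QuadraticAlgebra ℤ e t) = ⟨x, y⟩ := by
    apply φ.injective
    apply NumberField.RingOfIntegers.ext
    apply Subtype.ext
    rw [hxy, hφ]
    simp
  rw [satisfiesRC_iff hd hsq φ hη,
    forall_not_powersGenerateModulo_iff hsq het (congrArg QuadraticAlgebra.im hη_eq), hN]
  norm_cast
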